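/- Definitions. Let $P$ be a poset, $Q$ a finite poset and $r\ge 2$ an integer. For $A\subseteq P$ let $\ell(A)$ (the number of layers) be the cardinality of a longest chain in $A$; call $B\subseteq A$ maximally ordered in $A$ if the number of pairs $(a,b)\in B\times B$ with $a<b$ is maximal among all subsets of $A$ of cardinality $|B|$. For $\sigma\in\mathrm{Aut}(P)$ let $\Sigma(\sigma)=\{a\in P:\sigma(a)\ne a\}$. The automorphism $\sigma$ is a $(Q,r)$-generator with subsets $S_0,\dots,S_{r-1}\subsetneq\Sigma(\sigma)$ if each $S_i$ is isomorphic to $Q$, is maximally ordered in $\Sigma(\sigma)$, and $$\sigma(S_i)=S_{i+1 \bmod r},\qquad \ell(S_i)=\ell(\Sigma(\sigma)),\qquad \bigcup_{i=0}^{r-1}S_i=\Sigma(\sigma),$$ and $|S_i|$ is the smallest possible among all sequences of $r$ maximally ordered proper subsets of $\Sigma(\sigma)$ with these three properties. Elements $a,b\in P$ are $(Q,r,1)$-symmetric if for some $(Q,r)$-generator $\sigma$ with subsets $S_0,\dots,S_{r-1}$ there are $S_i\neq S_j$ and $1\le q<r$ with $a\in S_i$ and $b=\sigma^q(a)\in S_j$;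 they are $(Q,r)$-symmetric if they are joined by a finite (possibly empty) sequence of $(Q,r,1)$-symmetric steps. The retract $P\oslash_r Q$ is the set of equivalence classes of $(Q,r)$-symmetry, ordered by $A\le B$ iff $a\le b$ for some $a\in A$, $b\in B$. The poset $P$ is locally symmetric if, for some finite poset $Q$ and some $r\ge2$, the retract $P\oslash_r Q$ differs from $P$, that is, the canonical projection $P\to P\oslash_r Q$ is not an isomorphism; otherwise $P$ is locally unsymmetric. For $k\in\mathbb N_0$, $P$ is $k$-stable locally unsymmetric if $P\setminus F$ is locally unsymmetric for every $F\subseteq P$ with $|F|\le k$, and $P$ is total locally unsymmetric if it is $k$-stable locally unsymmetric for every finite $k<|P|$. Write $a\lessdot b$ if $a<b$ and no $c$ satisfies $a<c<b$. Elements $a,b$ of $P$ are singleton-symmetric if $\{c: c\lessdot a\}=\{c: c\lessdot b\}$ and $\{c: a\lessdot c\}=\{c: b\lessdot c\}$. Let $d\ge1$, and let $\mathbb M^d=\mathbb R^{1,d-1}$ be $d$-dimensional Minkowski spacetime with its Lebesgue volume measure $\nu$ and its causal order: $x\le y$ iff $y-x$ is zero or a future-directed timelike or lightlike vector. Let $\rho>0$.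 A sprinkle $\mathsf S$ in $\mathbb M^d$ of density $\rho$ is a random subset of $\mathbb M^d$, with the induced order, that forms a Poisson process of intensity $\rho\nu$: for every precompact Borel set $U$ the number $|\mathsf S\cap U|$ is a random variable with $$\Pr\bigl(|\mathsf S\cap U|=n\bigr)=\frac{\rho^n}{n!}\,\nu(U)^n\,e^{-\rho\nu(U)}\qquad(n\in\mathbb N_0),$$ and these numbers are independent for pairwise disjoint precompact Borel sets. Theorem. With probability 1, a sprinkle $\mathsf S$ in $\mathbb M^d$ is total locally unsymmetric. Also with probability 1, $\mathsf S$ does not contain any pair of distinct singleton-symmetric (non-Hegelian) elements. -/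

import Mathlib

open MeasureTheory ProbabilityTheory

namespace LocalSymmetry

universe u

/-! ### Local symmetries of posets -/

section Posets

/-- `B` is maximally ordered in `A`: `B ⊆ A`, and the number of pairs `(a, b) ∈ B × B` with `a < b`
is maximal among all subsets of `A` that have the same cardinality as `B`. -/
def MaximallyOrderedIn {P : Type u} [PartialOrder P] (B A : Set P) : Prop :=
  B ⊆ A ∧ ∀ C : Set P, C ⊆ A → C.encard = B.encard →
    {p : P × P | p.1 ∈ C ∧ p.2 ∈ C ∧ p.1 < p.2}.encard ≤
      {p : P × P | p.1 ∈ B ∧ p.2 ∈ B ∧ p.1 < p.2}.encard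

/-- The number of layers of a subset: the cardinality of its longest chain. -/
noncomputable def layers {P : Type u} [PartialOrder P] (A : Set P) : ℕ∞ :=
  A.chainHeight (· ≤ ·)

/-- `moved σ` is the set of all elements that are not fixed by the automorphism `σ`. -/
def moved {P : Type u} [PartialOrder P] (σ : P ≃o P) : Set P := {a | σ a ≠ a}

/-- `S` is a sequence of `r` maximally ordered proper subsets of `moved σ`, cyclically permuted
by `σ`, with as many layers as `moved σ`, and whose union is `moved σ`.
The index set `ZMod r` implements the indices `0, …, r - 1` modulo `r`. -/
structure IsCyclicCover {P : Type u} [PartialOrder P] (r : ℕ) (σ : P ≃o P) (S : ZMod r → Set P) :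
    Prop where
  ssubset : ∀ i, S i ⊂ moved σ
  maximallyOrdered : ∀ i, MaximallyOrderedIn (S i) (moved σ)
  image_eq : ∀ i, σ '' S i = S (i + 1)
  layers_eq : ∀ i, layers (S i) = layers (moved σ)
  iUnion_eq : ⋃ i, S i = moved σ

/-- The automorphism `σ` is a `(Q, r)`-generator with the sequence of subsets `S`: the `S i` are
isomorphic to `Q` and form a cyclic cover of `moved σ`, and they are the smallest such subsets
(the sets of one cyclic cover all have the same cardinality). -/
structure IsGenerator {P : Type u} [PartialOrder P] (Q : Type) [PartialOrder Q] (r : ℕ)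
    (σ : P ≃o P) (S : ZMod r → Set P) : Prop where
  cover : IsCyclicCover r σ S
  isom : ∀ i, Nonempty (S i ≃o Q)
  smallest : ∀ T : ZMod r → Set P, IsCyclicCover r σ T → ∀ i, (S i).encard ≤ (T i).encard

/-- `(Q, r, 1)`-symmetric elements: `a ∈ A` and `b = σ ^ q (a) ∈ B` with `1 ≤ q < r`, where `(A, B)`
is a distinct pair of the subsets that belong to a `(Q, r)`-generator `σ`. -/
def OneSymmetric {P : Type u} [PartialOrder P] (Q : Type) [PartialOrder Q] (r : ℕ) (a b : P) :
    Prop :=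
  ∃ (σ : P ≃o P) (S : ZMod r → Set P), IsGenerator Q r σ S ∧
    ∃ i j : ZMod r, S i ≠ S j ∧ a ∈ S i ∧ b ∈ S j ∧ ∃ q : ℕ, 1 ≤ q ∧ q < r ∧ b = σ^[q] a

/-- `(Q, r)`-symmetry of elements. Two elements are `(Q, r)`-symmetric if they are joined by a
finite (possibly empty) sequence of `(Q, r, 1)`-symmetric steps (the `n` of `(Q, r, n)`-symmetric
is the least number of steps), that is, if they are related under the equivalence relation
that `(Q, r, 1)`-symmetry generates. -/
def symmetricSetoid (P : Type u) [PartialOrder P] (Q : Type) [PartialOrder Q] (r : ℕ) : Setoid P :=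
  Relation.EqvGen.setoid (OneSymmetric Q r)

/-- The retract of `P` by all `(Q, r)`-symmetries: the set of equivalence classes. -/
def Retract (P : Type u) [PartialOrder P] (Q : Type) [PartialOrder Q] (r : ℕ) : Type u :=
  Quotient (symmetricSetoid P Q r)

/-- The canonical projection of a poset to its retract. -/
def Retract.proj {P : Type u} [PartialOrder P] (Q : Type) [PartialOrder Q] (r : ℕ) (a : P) :
    Retract P Q r :=
  Quotient.mk (symmetricSetoid P Q r) a

/-- The quotient order: `A ≤ B` if and only if `a ≤ b` for some `a ∈ A` and `b ∈ B`. -/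
instance (P : Type u) [PartialOrder P] (Q : Type) [PartialOrder Q] (r : ℕ) : LE (Retract P Q r) where
  le A B := ∃ a b : P, Retract.proj Q r a = A ∧ Retract.proj Q r b = B ∧ a ≤ b

/-- `P` is locally `(Q, r)`-symmetric: its retract by the `(Q, r)`-symmetries differs from `P`,
in the sense that the canonical projection is not an isomorphism. -/
def LocallySymmetricBy (P : Type u) [PartialOrder P] (Q : Type) [PartialOrder Q] (r : ℕ) : Prop :=
  ¬ ∃ e : P ≃o Retract P Q r, ∀ a, e a = Retract.proj Q r a

/-- `P` is locally symmetric if it is locally `(Q, r)`-symmetric for some finite poset `Q` and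
some `r ≥ 2`. (Every finite poset is isomorphic to one in `Type`.) -/
def LocallySymmetric (P : Type u) [PartialOrder P] : Prop :=
  ∃ (Q : Type) (_ : PartialOrder Q) (_ : Finite Q) (r : ℕ), 2 ≤ r ∧ LocallySymmetricBy P Q r

/-- Not locally symmetric. -/
def LocallyUnsymmetric (P : Type u) [PartialOrder P] : Prop := ¬ LocallySymmetric P

/-- `k`-stable locally unsymmetric: the poset that remains after the removal of any subset of at
most `k` elements is locally unsymmetric. -/
def StableLocallyUnsymmetric (k : ℕ) (P : Type u) [PartialOrder P] : Prop :=
  ∀ F : Set P, F.encard ≤ k → LocallyUnsymmetric {a : P // a ∉ F}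

/-- Total locally unsymmetric: `k`-stable locally unsymmetric for every finite `k < |P|`. -/
def TotalLocallyUnsymmetric (P : Type u) [PartialOrder P] : Prop :=
  ∀ k : ℕ, (k : ℕ∞) < ENat.card P → StableLocallyUnsymmetric k P

/-- The elements covered by `a`. -/
def linksBelow {P : Type u} [PartialOrder P] (a : P) : Set P := {c | c ⋖ a}

/-- The elements covering `a`. -/
def linksAbove {P : Type u} [PartialOrder P] (a : P) : Set P := {c | a ⋖ c}

/-- Two elements are singleton-symmetric if they have the same links in both directions. -/
def SingletonSymmetric {P : Type u} [PartialOrder P] (a b : P) : Prop :=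
  linksBelow a = linksBelow b ∧ linksAbove a = linksAbove b

end Posets

/-! ### Minkowski spacetime and sprinkling -/

section Spacetime

/-- Minkowski spacetime `ℝ^{1,s}` with one time dimension and `s` space dimensions; the first
component of a point is its time coordinate and the second its position in Euclidean space. -/
def Minkowski (s : ℕ) : Type := ℝ × EuclideanSpace ℝ (Fin s)

instance (s : ℕ) : TopologicalSpace (Minkowski s) :=
  inferInstanceAs (TopologicalSpace (ℝ × EuclideanSpace ℝ (Fin s)))

/-- The volume measure is the Lebesgue measure. -/
noncomputable instance (s : ℕ) : MeasureSpace (Minkowski s) :=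
  inferInstanceAs (MeasureSpace (ℝ × EuclideanSpace ℝ (Fin s)))

/-- The squared Lorentzian length of `y - x`, with signature `(+, -, …, -)`. -/
noncomputable def interval {s : ℕ} (x y : Minkowski s) : ℝ :=
  (y.1 - x.1) ^ 2 - ‖y.2 - x.2‖ ^ 2

theorem causal_iff {s : ℕ} (x y : Minkowski s) :
    (x.1 ≤ y.1 ∧ 0 ≤ interval x y) ↔ ‖y.2 - x.2‖ ≤ y.1 - x.1 := by
  unfold interval
  constructor
  · rintro ⟨h1, h2⟩
    exact le_of_sq_le_sq (by linarith) (by linarith)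
  · intro h
    have h0 := norm_nonneg (y.2 - x.2)
    exact ⟨by linarith, by nlinarith⟩

/-- The causal order: `x ≤ y` if `y - x` is zero or a future-directed timelike or lightlike vector. -/
noncomputable instance (s : ℕ) : PartialOrder (Minkowski s) where
  le x y := x.1 ≤ y.1 ∧ 0 ≤ interval x y
  le_refl x := (causal_iff x x).2 (by simp)
  le_trans x y z hxy hyz := by
    rw [causal_iff] at *
    have := norm_sub_le_norm_sub_add_norm_sub z.2 y.2 x.2
    linarith
  le_antisymm x y hxy hyx := by
    have h1 : x.1 = y.1 := le_antisymm hxy.1 hyx.1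
    have h2 := (causal_iff x y).1 hxy
    have h3 : ‖y.2 - x.2‖ ≤ 0 := by linarith
    exact Prod.ext h1 (sub_eq_zero.1 (norm_le_zero_iff.1 h3)).symm

/-- `S` is a sprinkling of density `ρ` in Minkowski spacetime: a random subset, defined on the
probability space `(Ω, μ)`, that forms a Poisson process whose intensity is `ρ` times the volume.
The number of points in a precompact Borel region `U` is Poisson distributed with mean `ρ ν(U)`
(in particular it is finite almost surely), and the numbers of points in pairwise disjoint such
regions are independent. -/
structure IsSprinkling {Ω : Type*} [MeasurableSpace Ω] (μ : Measure Ω) (s : ℕ) (ρ : ℝ)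
    (S : Ω → Set (Minkowski s)) : Prop where
  measurable_count : ∀ U : Set (Minkowski s), MeasurableSet U → IsCompact (closure U) →
    Measurable fun ω => (S ω ∩ U).encard
  count_law : ∀ U : Set (Minkowski s), MeasurableSet U → IsCompact (closure U) → ∀ n : ℕ,
    μ {ω | (S ω ∩ U).encard = n} =
      ENNReal.ofReal
        (ρ ^ n / (n.factorial : ℝ) * volume.real U ^ n * Real.exp (-(ρ * volume.real U)))
  indep : ∀ (m : ℕ) (U : Fin m → Set (Minkowski s)), (∀ i, MeasurableSet (U i)) →
    (∀ i, IsCompact (closure (U i))) → Pairwise (fun i j => Disjoint (U i) (U j)) →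
    iIndepFun (fun i ω => (S ω ∩ U i).encard) μ

end Spacetime

end LocalSymmetry

open Filter Topology

namespace LocalSymmetry

/-! ### Posets without finitely supported automorphisms -/

section Posets

variable {P : Type*} [PartialOrder P]

/-! Since `Q` is finite, a generator moves only finitely many points, so it suffices that no
nontrivial automorphism σ of the sprinkle minus a finite set F has finite support. For such a σ, a
moved point a is incomparable to σ a, as its orbit would otherwise be an infinite chain of moved
points. If infinitely many sprinkle points lie above a but not above σ a, one of them, c, avoids F
and is fixed; then a ≤ c gives σ a ≤ σ c = c, a contradiction.

These separating points come from null rays (`IsSprinkling.ae_infinite_future_diff`). For a unit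
vector u, the function f(t, x) = t - ⟨u, x⟩ is monotone for the causal order and constant along (1,
u). For incomparable a, b some u gives f(a) < f(b), so a thin tube along the ray from just above a
stays in the future of a and outside that of b (`nullBalls_subset`). The tube contains infinitely
many disjoint balls of equal volume, so it almost surely has infinitely many sprinkle points.
Countably many tubes serve all pairs a, b at once.

For links, intervals are almost surely finite, so a separating point c > a lies above some cover of
a; that cover is not above b, hence is no link of b. -/

theorem IsGenerator.finite_moved {Q : Type} [PartialOrder Q] [Finite Q] {r : ℕ} (hr : 2 ≤ r)
    {σ : P ≃o P} {S : ZMod r → Set P} (h : IsGenerator Q r σ S) : (moved σ).Finite := by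
  have : NeZero r := ⟨by omega⟩
  rw [← h.cover.iUnion_eq]
  refine Set.finite_iUnion fun i => ?_
  obtain ⟨e⟩ := h.isom i
  have : Finite (S i) := Finite.of_equiv Q e.symm.toEquiv
  exact Set.toFinite _

/-- A poset without nontrivial finitely supported automorphisms is locally unsymmetric. -/
theorem locallyUnsymmetric_of_moved
    (h : ∀ σ : P ≃o P, (moved σ).Finite → moved σ = ∅) : LocallyUnsymmetric P := by
  rintro ⟨Q, _, _, r, hr, hsym⟩
  have hone : ∀ a b : P, ¬ OneSymmetric Q r a b := by
    rintro a b ⟨σ, S, hS, i, -, -, ha, -⟩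
    have h1 := (hS.cover.ssubset i).subset ha
    rw [h σ (hS.finite_moved hr)] at h1
    exact h1
  have heq : ∀ a b : P, Retract.proj Q r a = Retract.proj Q r b → a = b := by
    intro a b hab
    have hab' : Relation.EqvGen (OneSymmetric Q r) a b := Quotient.exact hab
    induction hab' with
    | rel x y hxy => exact (hone x y hxy).elim
    | refl x => rfl
    | symm x y _ ih => exact (ih (by assumption : _ = _).symm).symm
    | trans x y z hxy hyz ih1 ih2 => exact (ih1 (Quotient.sound hxy)).trans (ih2 (Quotient.sound hyz))
  refine hsym ⟨⟨Equiv.ofBijective (Retract.proj Q r) ⟨fun a b => heq a b, Quotient.exists_rep⟩, ?_⟩,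
    fun a => rfl⟩
  intro a b
  constructor
  · rintro ⟨x, y, hx, hy, hxy⟩
    rwa [← heq _ _ hx, ← heq _ _ hy]
  · exact fun hab => ⟨a, b, rfl, rfl, hab⟩

theorem iterate_mem_moved (σ : P ≃o P) {a : P} (ha : a ∈ moved σ) (n : ℕ) :
    σ^[n] a ∈ moved σ := by
  intro h
  have h' : σ^[n] (σ a) = σ^[n] a := by
    rw [← Function.iterate_succ_apply, Function.iterate_succ_apply']
    exact h
  exact ha (σ.injective.iterate n h')

/-- Otherwise the iterates of a form an infinite ascending chain, all of it moved. -/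
theorem not_lt_apply_of_finite_moved (σ : P ≃o P) (hfin : (moved σ).Finite) (a : P) :
    ¬ a < σ a := by
  intro h
  have hmono : StrictMono fun n : ℕ => σ^[n] a :=
    strictMono_nat_of_lt_succ fun n => by
      simp only [Function.iterate_succ_apply]
      exact σ.strictMono.iterate n h
  exact Set.infinite_range_of_injective hmono.injective
    (hfin.subset (Set.range_subset_iff.2 fun n => iterate_mem_moved σ h.ne' n))

theorem not_apply_lt_of_finite_moved (σ : P ≃o P) (hfin : (moved σ).Finite) (a : P) :
    ¬ σ a < a := by
  intro h
  have hanti : StrictAnti fun n : ℕ => σ^[n] a :=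
    strictAnti_nat_of_succ_lt fun n => by
      simp only [Function.iterate_succ_apply]
      exact σ.strictMono.iterate n h
  exact Set.infinite_range_of_injective hanti.injective
    (hfin.subset (Set.range_subset_iff.2 fun n => iterate_mem_moved σ h.ne n))

/-- If any two incomparable elements are distinguished by infinitely many elements above the first,
then the poset is total locally unsymmetric. -/
theorem totalLocallyUnsymmetric_of_infinite
    (h : ∀ a b : P, ¬ a ≤ b → ¬ b ≤ a → {c | a ≤ c ∧ ¬ b ≤ c}.Infinite) :
    TotalLocallyUnsymmetric P := by
  intro k _ F hF
  have hFfin : F.Finite := Set.finite_of_encard_le_coe hF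
  refine locallyUnsymmetric_of_moved fun σ hfin => Set.eq_empty_of_forall_notMem fun a ha => ?_
  have h1 : ¬ a ≤ σ a := fun hle =>
    not_lt_apply_of_finite_moved σ hfin a (lt_of_le_of_ne hle (Ne.symm ha))
  have h2 : ¬ σ a ≤ a := fun hle =>
    not_apply_lt_of_finite_moved σ hfin a (lt_of_le_of_ne hle ha)
  -- F and the support are both finite, so some witness survives the deletion of F and is fixed by
  -- σ.
  obtain ⟨c, ⟨hac, hbc⟩, hc⟩ :=
    (h a.1 (σ a).1 h1 h2).exists_notMem_finite (hFfin.union (hfin.image Subtype.val))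
  rw [Set.mem_union, not_or] at hc
  have hfix : σ ⟨c, hc.1⟩ = ⟨c, hc.1⟩ := by
    by_contra hne
    exact hc.2 ⟨⟨c, hc.1⟩, hne, rfl⟩
  have h3 : σ a ≤ σ ⟨c, hc.1⟩ := σ.monotone hac
  rw [hfix] at h3
  exact hbc h3

/-- A minimal element of the finite nonempty set (a, b] covers a. -/
theorem exists_covBy_le_of_finite_Icc {a b : P} (hab : a < b) (hfin : (Set.Icc a b).Finite) :
    ∃ c, a ⋖ c ∧ c ≤ b := by
  obtain ⟨c, hc⟩ := (hfin.subset Set.Ioc_subset_Icc_self).exists_minimal ⟨b, hab, le_rfl⟩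
  refine ⟨c, ⟨hc.prop.1, fun d had hdc => ?_⟩, hc.prop.2⟩
  exact (hc.le_of_le ⟨had, hdc.le.trans hc.prop.2⟩ hdc.le).not_gt hdc

/-- In a poset with finite intervals, elements with the same links above are equal if incomparable
elements are distinguished by the elements above the first. -/
theorem not_singletonSymmetric (hfin : ∀ a b : P, (Set.Icc a b).Finite)
    (h : ∀ a b : P, ¬ a ≤ b → ¬ b ≤ a → {c | a ≤ c ∧ ¬ b ≤ c}.Infinite) {a b : P} (hab : a ≠ b) :
    ¬ SingletonSymmetric a b := by
  have key : ∀ a b c : P, a < c → ¬ b < c → linksAbove a ≠ linksAbove b := by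
    intro a b c hac hbc heq
    obtain ⟨d, had, hdc⟩ := exists_covBy_le_of_finite_Icc hac (hfin a c)
    have hbd : d ∈ linksAbove b := heq ▸ had
    exact hbc (lt_of_lt_of_le hbd.lt hdc)
  rintro ⟨-, hlinks⟩
  by_cases h1 : a ≤ b
  -- For comparable elements the larger one is itself the separating point.
  · exact key a b b (lt_of_le_of_ne h1 hab) (lt_irrefl b) hlinks
  by_cases h2 : b ≤ a
  · exact key b a a (lt_of_le_of_ne h2 hab.symm) (lt_irrefl a) hlinks.symm
  obtain ⟨c, ⟨hac, hbc⟩, hne⟩ := (h a b h1 h2).exists_notMem_finite (Set.finite_singleton a)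
  exact key a b c (lt_of_le_of_ne hac (Ne.symm hne)) (fun hlt => hbc hlt.le) hlinks

end Posets

/-! ### Almost sure properties of sprinklings -/

section Sprinkling

variable {s : ℕ}

theorem Minkowski.le_iff (x y : Minkowski s) : x ≤ y ↔ ‖y.2 - x.2‖ ≤ y.1 - x.1 :=
  causal_iff x y

variable {ρ : ℝ} {Ω : Type*} [MeasurableSpace Ω] {μ : Measure Ω}
  {S : Ω → Set (ℝ × EuclideanSpace ℝ (Fin s))}

/-- The plain product carries the metric that `Minkowski s` is not given; it is proper, so bounded
sets are precompact. -/
theorem IsSprinkling.count_law_of_isBounded (hS : IsSprinkling μ s ρ S)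
    {U : Set (ℝ × EuclideanSpace ℝ (Fin s))} (hU : MeasurableSet U) (hb : Bornology.IsBounded U)
    (n : ℕ) :
    μ {ω | (S ω ∩ U).encard = n} =
      ENNReal.ofReal
        (ρ ^ n / (n.factorial : ℝ) * volume.real U ^ n * Real.exp (-(ρ * volume.real U))) :=
  hS.count_law U hU hb.isCompact_closure n

theorem IsSprinkling.measure_inter_eq_empty (hS : IsSprinkling μ s ρ S)
    {U : Set (ℝ × EuclideanSpace ℝ (Fin s))} (hU : MeasurableSet U)
    (hb : Bornology.IsBounded U) :
    μ {ω | S ω ∩ U = ∅} = ENNReal.ofReal (Real.exp (-(ρ * volume.real U))) := by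
  simpa using hS.count_law_of_isBounded hU hb 0

/-- A sprinkling is almost surely finite on every bounded Borel set. -/
theorem IsSprinkling.ae_finite_inter [IsProbabilityMeasure μ] (hρ : 0 < ρ)
    (hS : IsSprinkling μ s ρ S)
    {U : Set (ℝ × EuclideanSpace ℝ (Fin s))} (hU : MeasurableSet U)
    (hb : Bornology.IsBounded U) : ∀ᵐ ω ∂μ, (S ω ∩ U).Finite := by
  have hmeas : Measurable fun ω => (S ω ∩ U).encard :=
    hS.measurable_count U hU hb.isCompact_closure
  have hset : {ω | (S ω ∩ U).Finite} = ⋃ n : ℕ, {ω | (S ω ∩ U).encard = n} := by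
    ext ω
    simp only [Set.mem_ofPred_eq, Set.mem_iUnion]
    exact ⟨fun h => ⟨_, h.encard_eq_coe⟩, fun ⟨n, hn⟩ => Set.finite_of_encard_eq_coe hn⟩
  have hmeasn : ∀ n : ℕ, MeasurableSet {ω | (S ω ∩ U).encard = n} := fun n =>
    hmeas (measurableSet_singleton _)
  refine (prob_compl_eq_zero_iff ?_).2 ?_
  · rw [hset]
    exact MeasurableSet.iUnion hmeasn
  · set x := ρ * volume.real U with hx
    have hx0 : 0 ≤ x := mul_nonneg hρ.le measureReal_nonneg
    rw [hset, measure_iUnion _ hmeasn]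
    -- The Poisson weights sum to 1, which leaves no mass for an infinite count.
    · have hsum : HasSum (fun n : ℕ => x ^ n / (n.factorial : ℝ) * Real.exp (-x)) 1 := by
        have := (NormedSpace.expSeries_div_hasSum_exp x).mul_right (Real.exp (-x))
        rwa [← Real.exp_eq_exp_ℝ, ← Real.exp_add, add_neg_cancel, Real.exp_zero] at this
      rw [← ENNReal.ofReal_one, ← hsum.tsum_eq, ENNReal.ofReal_tsum_of_nonneg
        (fun n => by positivity) hsum.summable]
      refine tsum_congr fun n => ?_
      rw [hS.count_law_of_isBounded hU hb n]
      congr 2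
      rw [hx, mul_pow]
      ring
    · intro m n hmn
      refine Set.disjoint_left.2 fun ω hm hn => hmn ?_
      exact_mod_cast hm.symm.trans hn

/-- A sprinkling almost surely has infinitely many points in a disjoint union of infinitely many
bounded Borel sets of the same positive volume. -/
theorem IsSprinkling.ae_infinite_inter_iUnion [IsProbabilityMeasure μ] (hρ : 0 < ρ)
    (hS : IsSprinkling μ s ρ S) {W : ℕ → Set (ℝ × EuclideanSpace ℝ (Fin s))}
    (hW : ∀ n, MeasurableSet (W n)) (hb : ∀ n, Bornology.IsBounded (W n))
    (hd : Pairwise fun m n => Disjoint (W m) (W n)) {v : ℝ} (hv : 0 < v)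
    (hvol : ∀ n, volume.real (W n) = v) : ∀ᵐ ω ∂μ, (S ω ∩ ⋃ n, W n).Infinite := by
  have hae : ∀ m : ℕ, ∀ᵐ ω ∂μ, ∃ n ≥ m, (S ω ∩ W n).Nonempty := by
    intro m
    -- The union of k consecutive sets is bounded of volume k v, so its void probability exp(-ρ k v)
    -- tends to 0; this takes the place of a Borel–Cantelli argument.
    have hle : ∀ k : ℕ, μ {ω | ¬ ∃ n ≥ m, (S ω ∩ W n).Nonempty} ≤
        ENNReal.ofReal (Real.exp (-(ρ * (k * v)))) := by
      intro k
      have hU := hS.measure_inter_eq_empty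
        (U := ⋃ n ∈ Finset.Ico m (m + k), W n)
        (Finset.measurableSet_biUnion _ fun n _ => hW n)
        ((Bornology.isBounded_biUnion_finset _).2 fun n _ => hb n)
      rw [measureReal_biUnion_finset (fun i _ j _ hij => hd hij) (fun n _ => hW n)
        (fun n _ => (hb n).measure_lt_top.ne), Finset.sum_congr rfl fun n _ => hvol n,
        Finset.sum_const, Nat.card_Ico, Nat.add_sub_cancel_left, nsmul_eq_mul] at hU
      rw [← hU]
      refine measure_mono fun ω hω => Set.eq_empty_of_forall_notMem ?_
      rintro c ⟨hc, hcU⟩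
      simp only [Set.mem_iUnion, Finset.mem_Ico] at hcU
      obtain ⟨n, hn, hcn⟩ := hcU
      exact hω ⟨n, hn.1, c, hc, hcn⟩
    have hlim : Tendsto (fun k : ℕ => ENNReal.ofReal (Real.exp (-(ρ * (k * v))))) atTop (𝓝 0) := by
      rw [← ENNReal.ofReal_zero]
      refine ENNReal.tendsto_ofReal (Real.tendsto_exp_neg_atTop_nhds_zero.comp ?_)
      exact (tendsto_natCast_atTop_atTop.atTop_mul_const hv).const_mul_atTop hρ
    exact le_antisymm (ge_of_tendsto' hlim hle) bot_le
  filter_upwards [ae_all_iff.2 hae] with ω hω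
  have hinf : {n | (S ω ∩ W n).Nonempty}.Infinite :=
    Set.infinite_of_forall_exists_gt fun m => by
      obtain ⟨n, hn, h⟩ := hω (m + 1)
      exact ⟨n, h, hn⟩
  have : Infinite {n | (S ω ∩ W n).Nonempty} := hinf.to_subtype
  -- Points picked from different `W n` differ by disjointness.
  choose f hf using fun n : {n | (S ω ∩ W n).Nonempty} => n.2
  refine (Set.infinite_range_of_injective (f := f) fun m n hmn => ?_).mono
    (Set.range_subset_iff.2 fun n => ⟨(hf n).1, Set.mem_iUnion.2 ⟨n, (hf n).2⟩⟩)
  by_contra hne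
  exact Set.disjoint_left.1 (hd fun h => hne (Subtype.ext h)) (hf m).2 (hmn ▸ (hf n).2)

/-- The balls of radius `ε` around the points `p + n (1, u)`. -/
def nullBalls (p : ℝ × EuclideanSpace ℝ (Fin s)) (u : EuclideanSpace ℝ (Fin s)) (ε : ℝ) (n : ℕ) :
    Set (ℝ × EuclideanSpace ℝ (Fin s)) :=
  Metric.ball (p + (n : ℝ) • ((1 : ℝ), u)) ε

/-- The product carries the sup metric, and the time coordinates of two centres differ by at least 1
≥ 2ε. -/
theorem disjoint_nullBalls (p : ℝ × EuclideanSpace ℝ (Fin s)) (u : EuclideanSpace ℝ (Fin s))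
    {ε : ℝ} (hε : ε ≤ 1 / 2) :
    Pairwise fun m n => Disjoint (nullBalls p u ε m) (nullBalls p u ε n) := by
  intro m n hmn
  refine Metric.ball_disjoint_ball (le_trans (by linarith : ε + ε ≤ 1) ?_)
  rw [Prod.dist_eq]
  refine le_max_of_le_left ?_
  simp only [Prod.fst_add, Prod.smul_fst, smul_eq_mul, mul_one, dist_add_left]
  rw [Real.dist_eq]
  have h : (1 : ℤ) ≤ |(m : ℤ) - n| := Int.one_le_abs (sub_ne_zero.2 (by exact_mod_cast hmn))
  exact_mod_cast h

/-- Translation invariance of Lebesgue measure gives all the balls the same volume. -/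
theorem IsSprinkling.ae_infinite_inter_nullBalls [IsProbabilityMeasure μ] (hρ : 0 < ρ)
    (hS : IsSprinkling μ s ρ S) (p : ℝ × EuclideanSpace ℝ (Fin s))
    (u : EuclideanSpace ℝ (Fin s)) {ε : ℝ} (hε0 : 0 < ε) (hε : ε ≤ 1 / 2) :
    ∀ᵐ ω ∂μ, (S ω ∩ ⋃ n, nullBalls p u ε n).Infinite := by
  have : (volume : Measure (ℝ × EuclideanSpace ℝ (Fin s))).IsAddHaarMeasure :=
    Measure.prod.instIsAddHaarMeasure volume volume
  refine hS.ae_infinite_inter_iUnion hρ (fun n => measurableSet_ball)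
    (fun n => Metric.isBounded_ball) (disjoint_nullBalls p u hε)
    (v := volume.real (Metric.ball (0 : ℝ × EuclideanSpace ℝ (Fin s)) ε)) ?_ fun n => ?_
  · exact ENNReal.toReal_pos (Metric.measure_ball_pos volume _ hε0).ne' measure_ball_lt_top.ne
  · simp only [Measure.real, nullBalls]
    rw [Measure.addHaar_ball_center]

/-- The points of the `ε`-balls around `p + n (1, u)` are in the future of `a` but not of `b`, if
`p` is close to `a`, and `b` is beyond the null hyperplane through `a` in direction `u`. -/
theorem nullBalls_subset {a b p : ℝ × EuclideanSpace ℝ (Fin s)} {u : EuclideanSpace ℝ (Fin s)}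
    {ε : ℝ} (hu : ‖u‖ = 1) (hab : 8 * ε ≤ (b.1 - a.1) - inner ℝ u (b.2 - a.2))
    (hp : dist p (a + (4 * ε, 0)) < ε) (n : ℕ) :
    nullBalls p u ε n ⊆ {c | ‖c.2 - a.2‖ ≤ c.1 - a.1 ∧ ¬ ‖c.2 - b.2‖ ≤ c.1 - b.1} := by
  intro c hc
  rw [nullBalls, Metric.mem_ball, Prod.dist_eq, max_lt_iff, Real.dist_eq, dist_eq_norm,
    abs_lt] at hc
  rw [Prod.dist_eq, max_lt_iff, Real.dist_eq, dist_eq_norm, abs_lt] at hp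
  simp only [Prod.fst_add, Prod.snd_add, Prod.smul_fst, Prod.smul_snd, smul_eq_mul, mul_one,
    add_zero] at hc hp
  obtain ⟨⟨hc1, hc2⟩, hc3⟩ := hc
  obtain ⟨⟨hp1, hp2⟩, hp3⟩ := hp
  -- The spatial deviation of c from a + n (1, u) is less than 2ε, while c is later than that point
  -- by more than 2ε and less than 6ε: hence the offset 4ε in `hp`.
  set e := (c.2 - (p.2 + (n : ℝ) • u)) + (p.2 - a.2) with he
  have hen : ‖e‖ < 2 * ε := by
    have := norm_add_le (c.2 - (p.2 + (n : ℝ) • u)) (p.2 - a.2)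
    linarith
  have hnu : ‖(n : ℝ) • u‖ = n := by simp [norm_smul, hu]
  constructor
  · have h1 : c.2 - a.2 = e + (n : ℝ) • u := by rw [he]; abel
    have h2 := norm_add_le e ((n : ℝ) • u)
    rw [h1]
    linarith
  -- With f(t, x) = t - ⟨u, x⟩, f(c) - f(a) < 6ε + 2ε ≤ f(b) - f(a), whereas c in the future of b
  -- would force f(c) ≥ f(b) by Cauchy–Schwarz.
  · intro h
    have h1 : c.2 - b.2 = e + (n : ℝ) • u - (b.2 - a.2) := by rw [he]; abel
    have h2 := real_inner_le_norm u (c.2 - b.2)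
    have h3 := neg_le_of_abs_le (abs_real_inner_le_norm u e)
    have h4 : inner ℝ u (c.2 - b.2) = inner ℝ u e + n - inner ℝ u (b.2 - a.2) := by
      rw [h1, inner_sub_right, inner_add_right, real_inner_smul_right,
        real_inner_self_eq_norm_sq, hu]
      ring
    rw [hu, one_mul] at h2 h3
    linarith

/-- Two incomparable points are separated by null hyperplanes with directions in a dense set. -/
theorem exists_null_direction {D : Set (Metric.sphere (0 : EuclideanSpace ℝ (Fin s)) 1)}
    (hD : Dense D) {a b : ℝ × EuclideanSpace ℝ (Fin s)} (hab : ¬ ‖b.2 - a.2‖ ≤ b.1 - a.1)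
    (hba : ¬ ‖a.2 - b.2‖ ≤ a.1 - b.1) :
    ∃ u ∈ D, 0 < (b.1 - a.1) - inner ℝ (u : EuclideanSpace ℝ (Fin s)) (b.2 - a.2) := by
  set x := b.2 - a.2 with hx
  rw [norm_sub_rev, ← hx] at hba
  -- Points at the same position are comparable; this also disposes of s = 0, where the sphere is
  -- empty.
  have hx0 : 0 < ‖x‖ := by
    by_contra h
    rcases le_total 0 (b.1 - a.1) with h' | h' <;> linarith
  have hopen : IsOpen {u : Metric.sphere (0 : EuclideanSpace ℝ (Fin s)) 1 |
      0 < (b.1 - a.1) - inner ℝ (u : EuclideanSpace ℝ (Fin s)) x} :=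
    isOpen_lt continuous_const (by fun_prop)
  -- The direction -x/‖x‖ from b towards a turns the expression into (b.1 - a.1) + ‖x‖, positive by
  -- `hba`; openness then moves u into D.
  obtain ⟨u, hu, huD⟩ := hD.inter_open_nonempty _ hopen
    ⟨⟨-(‖x‖⁻¹ • x), by simp [norm_smul, hx0.ne']⟩, by
      simp only [Set.mem_ofPred_eq, inner_neg_left, real_inner_smul_left,
        real_inner_self_eq_norm_sq]
      have : ‖x‖⁻¹ * ‖x‖ ^ 2 = ‖x‖ := by field_simp
      linarith⟩
  exact ⟨u, huD, hu⟩

/-- Almost surely, any two incomparable points of spacetime are distinguished by infinitely many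
points of the sprinkling in the future of the first point. -/
theorem IsSprinkling.ae_infinite_future_diff [IsProbabilityMeasure μ] (hρ : 0 < ρ)
    {S : Ω → Set (Minkowski s)} (hS : IsSprinkling μ s ρ S) :
    ∀ᵐ ω ∂μ, ∀ a b : Minkowski s, ¬ a ≤ b → ¬ b ≤ a →
      {c | c ∈ S ω ∧ a ≤ c ∧ ¬ b ≤ c}.Infinite := by
  let T : Ω → Set (ℝ × EuclideanSpace ℝ (Fin s)) := S
  obtain ⟨D, hDc, hD⟩ := TopologicalSpace.exists_countable_dense
    (Metric.sphere (0 : EuclideanSpace ℝ (Fin s)) 1)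
  obtain ⟨E, hEc, hE⟩ := TopologicalSpace.exists_countable_dense (ℝ × EuclideanSpace ℝ (Fin s))
  -- Countably many directions, base points and radii give one null set valid for all a, b. The
  -- radii 1/(k + 2) are at most 1/2, as disjointness needs.
  have hae : ∀ᵐ ω ∂μ, ∀ u ∈ D, ∀ p ∈ E, ∀ k : ℕ,
      (T ω ∩ ⋃ n, nullBalls p u (1 / ((k + 1 : ℕ) + 1 : ℝ)) n).Infinite := by
    refine (ae_ball_iff hDc).2 fun u _ => (ae_ball_iff hEc).2 fun p _ => ae_all_iff.2 fun k => ?_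
    refine hS.ae_infinite_inter_nullBalls (S := T) hρ p u (by positivity) ?_
    refine one_div_le_one_div_of_le two_pos ?_
    push_cast
    linarith [(Nat.cast_nonneg k : (0 : ℝ) ≤ k)]
  filter_upwards [hae] with ω hω a b hab hba
  rw [Minkowski.le_iff] at hab hba
  obtain ⟨u, huD, hu⟩ := exists_null_direction hD hab hba
  -- An eighth of the gap, because `nullBalls_subset` consumes 8ε of it.
  obtain ⟨k, hk⟩ := exists_nat_one_div_lt (div_pos hu (by norm_num : (0 : ℝ) < 8))
  have hk' : 1 / ((k + 1 : ℕ) + 1 : ℝ) ≤ 1 / ((k : ℝ) + 1) :=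
    one_div_le_one_div_of_le (by positivity) (by push_cast; linarith)
  set ε : ℝ := 1 / ((k + 1 : ℕ) + 1 : ℝ) with hε
  have hε0 : 0 < ε := by positivity
  obtain ⟨p, hp, hpE⟩ := Metric.dense_iff.1 hE (show ℝ × EuclideanSpace ℝ (Fin s) from
    ((a.1 + 4 * ε, a.2 + 0))) ε hε0
  refine (hω u huD p hpE k).mono ?_
  rintro c ⟨hc, hcW⟩
  obtain ⟨n, hn⟩ := Set.mem_iUnion.1 hcW
  have h := nullBalls_subset (a := a) (b := b) (by simp) (by linarith) hp n hn
  exact ⟨hc, (Minkowski.le_iff _ _).2 h.1, fun hbc => h.2 ((Minkowski.le_iff _ _).1 hbc)⟩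

/-- Almost surely, all causal intervals of a sprinkling are finite. -/
theorem IsSprinkling.ae_finite_interval [IsProbabilityMeasure μ] (hρ : 0 < ρ)
    {S : Ω → Set (Minkowski s)} (hS : IsSprinkling μ s ρ S) :
    ∀ᵐ ω ∂μ, ∀ a b : Minkowski s, {c | c ∈ S ω ∧ a ≤ c ∧ c ≤ b}.Finite := by
  let T : Ω → Set (ℝ × EuclideanSpace ℝ (Fin s)) := S
  have hae : ∀ᵐ ω ∂μ, ∀ n : ℕ,
      (T ω ∩ Metric.ball (0 : ℝ × EuclideanSpace ℝ (Fin s)) n).Finite :=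
    ae_all_iff.2 fun n => hS.ae_finite_inter (S := T) hρ measurableSet_ball Metric.isBounded_ball
  filter_upwards [hae] with ω hω a b
  -- Causal intervals are bounded: a.1 ≤ c.1 ≤ b.1 and ‖c.2 - a.2‖ ≤ c.1 - a.1 ≤ b.1 - a.1.
  obtain ⟨n, hn⟩ := exists_nat_gt (|a.1| + |b.1| + ‖a.2‖ + (b.1 - a.1))
  refine (hω n).subset ?_
  rintro (c : Minkowski s) ⟨hc, hac, hcb⟩
  rw [Minkowski.le_iff] at hac hcb
  refine ⟨hc, ?_⟩
  have h1 := norm_nonneg (c.2 - a.2)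
  have h2 := norm_nonneg (b.2 - c.2)
  have h3 : ‖c.2‖ ≤ ‖a.2‖ + ‖c.2 - a.2‖ := by
    have := norm_add_le a.2 (c.2 - a.2)
    rwa [add_sub_cancel] at this
  have h4 := norm_nonneg a.2
  refine mem_ball_zero_iff.2
    ((Prod.norm_def (c : ℝ × EuclideanSpace ℝ (Fin s))).trans_lt (max_lt ?_ ?_))
  · rw [Real.norm_eq_abs, abs_lt]
    constructor <;> linarith [neg_abs_le a.1, le_abs_self b.1, abs_nonneg a.1, abs_nonneg b.1]
  · linarith [abs_nonneg a.1, abs_nonneg b.1]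

end Sprinkling

end LocalSymmetry

theorem mainTheorem8 (s : ℕ) (ρ : ℝ) (hρ : 0 < ρ)
    {Ω : Type*} [MeasurableSpace Ω] (μ : Measure Ω) [IsProbabilityMeasure μ]
    (S : Ω → Set (LocalSymmetry.Minkowski s)) (hS : LocalSymmetry.IsSprinkling μ s ρ S) :
    (∀ᵐ ω ∂μ, LocalSymmetry.TotalLocallyUnsymmetric (S ω)) ∧
      ∀ᵐ ω ∂μ, ∀ a b : S ω, a ≠ b → ¬ LocalSymmetry.SingletonSymmetric a b := by
  have hinf := hS.ae_infinite_future_diff hρ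
  have hfin := hS.ae_finite_interval hρ
  have hsub : ∀ ω, (∀ a b : LocalSymmetry.Minkowski s, ¬ a ≤ b → ¬ b ≤ a →
      {c | c ∈ S ω ∧ a ≤ c ∧ ¬ b ≤ c}.Infinite) →
      ∀ a b : S ω, ¬ a ≤ b → ¬ b ≤ a → {c | a ≤ c ∧ ¬ b ≤ c}.Infinite := by
    intro ω h a b hab hba hf
    refine h a b hab hba ((hf.image Subtype.val).subset ?_)
    rintro c ⟨hc, hc'⟩
    exact ⟨⟨c, hc⟩, hc', rfl⟩
  constructor
  · filter_upwards [hinf] with ω h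
    exact LocalSymmetry.totalLocallyUnsymmetric_of_infinite (hsub ω h)
  · filter_upwards [hinf, hfin] with ω h h' a b hab
    refine LocalSymmetry.not_singletonSymmetric (fun a b => ?_) (hsub ω h) hab
    refine ((h' a b).preimage Subtype.val_injective.injOn).subset fun c hc => ?_
    exact ⟨c.2, hc.1, hc.2⟩
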